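/- Let $k$ be a finite field of characteristic two, $V$ a $k$-vector space with $\dim_k V = 2n$, $n\ge 4$, and $q:V\to k$ a quadratic form whose polar form $B(x,y)=q(x+y)-q(x)-q(y)$ is nondegenerate. Let $\mathrm{Tr}:k\to\mathbb F_2$ be the trace, $\widehat q(x)=e^{2\pi i\,\mathrm{Tr}(q(x))/2}$, $\omega(x,y)=e^{2\pi i\,\mathrm{Tr}(B(x,y))/2}$ and $\widehat V=\mathrm{Hom}(V,\mathbb C^*)$. Let $\mathrm{Sp}_k(V,\omega_q)$ and $O_k(V,q)$ be the groups of $k$-linear automorphisms of $V$ preserving $B$ and $q$, and let $\Omega_k(V,q)\subset O_k(V,q)$ be the subgroup of elements with Dickson invariant zero, that is, of those acting trivially on the center of the even Clifford algebra of $q$. Let $\mathrm{Sp}(V,\omega)$ and $O(V,\widehat q)$ be the groups of automorphisms of the abelian group $V$ preserving $\omega$ and $\widehat q$. Given a normalized 2-cocycle $\alpha:V\times V\to\mathbb C^*$ with $\alpha(x,y)/\alpha(y,x)=\omega(x,y)$, let $A=\mathbb C_\alpha[V]$ be the twisted group algebra, with basis $(u_x)_{x\in V}$ and product $u_xu_y=\alpha(x,y)u_{x+y}$,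 on which $v\in V$ acts by $u_x\mapsto\omega(v,x)u_x$; then $\widehat V\cong\mathrm{Aut}_V(A)$ (the $V$-equivariant algebra automorphisms), where $\chi$ acts by $u_x\mapsto\chi(x)u_x$. Given a group $X$ of automorphisms of $V$ and, for each $g\in X$, a function $\eta_g:V\to\mathbb C^*$ such that $\alpha_g:u_x\mapsto\eta_g(x)u_{g(x)}$ is an algebra automorphism of $A$, with $\eta_1=1$, the crossed product $\widehat V\#_\theta X$ is the set $\widehat V\times X$ with the product $(\chi,g)(\psi,h)=(\chi\cdot{}^g\psi\cdot\theta(g,h),gh)$, where ${}^g\psi=\alpha_g\psi\alpha_g^{-1}$ and $\theta(g,h)=\alpha_g\alpha_h\alpha_{gh}^{-1}$; it is an extension of $X$ by $\widehat V$. (a) Such $\alpha$ and $(\eta_g)_{g\in \mathrm{Sp}(V,\omega)}$ exist. For any such choice, let $\mathrm{APs}_k(V)=\widehat V\#_\theta \mathrm{Sp}_k(V,\omega_q)$ be the restriction of $\widehat V\#_\theta\mathrm{Sp}(V,\omega)$ to $\mathrm{Sp}_k(V,\omega_q)$. (b) There exist a bicharacter $b:V\times V\to\mathbb C^*$ with $b(x,x)=\widehat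 q(x)$ (so that $\alpha=b$ is as above) and, for $\alpha=b$, functions $(\eta_g)_{g\in O(V,\widehat q)}$ as above with $\eta_g(0)=1$, with values in $\{\pm1\}$, with $\eta_g(x+x)=\eta_g(x)^2$ and with $\eta_g(x)\eta_g(y)/\eta_g(x+y)$ a bicharacter. For any such choice, let $\mathrm{Ps}_k(V,q)=\widehat V\#_\theta O_k(V,q)$ and $\widehat V\#_\theta\Omega_k(V,q)$ be the restrictions of $\widehat V\#_\theta O(V,\widehat q)$. Then, for all such choices, none of the three exact sequences $$0\to \widehat{V}\to \mathrm{APs}_k(V)\to \mathrm{Sp}_k(V,\omega_q)\to 1,$$ $$0\to \widehat{V}\to \mathrm{Ps}_k(V,q)\to O_k(V,q)\to 1,$$ $$0\to \widehat{V}\to \widehat{V}\#_{\theta}\Omega_k(V,q)\to \Omega_k(V,q)\to 1$$ splits. -/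

import Mathlib

namespace PseudoSymplectic

noncomputable section

/-! ### Crossed products of groups -/

/-- An `X`-crossed system over `N`: maps `(x, n) ↦ ˣn` and `θ : X × X → N` for which
`(n, x)(m, y) = (n (ˣm) θ(x, y), xy)` is a group law on `N × X` with unit `(1, 1)`. -/
structure CrossedSystem (X N : Type*) [Group X] [Group N] where
  act : X → N → N
  θ : X → X → N
  act_mul : ∀ x n m, act x (n * m) = act x n * act x m
  θ_act : ∀ x y n, θ x y * act (x * y) n = act x (act y n) * θ x y
  θ_assoc : ∀ x y z, θ x y * θ (x * y) z = act x (θ y z) * θ x (y * z)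
  θ_one_right : ∀ x, θ x 1 = 1
  θ_one_left : ∀ x, θ 1 x = 1
  act_one : ∀ n, act 1 n = n

namespace CrossedSystem

variable {X Y N M : Type*} [Group X] [Group Y] [Group N] [Group M]

/-- The crossed product `N #_θ X`. -/
@[ext]
structure Product (S : CrossedSystem X N) where
  fst : N
  snd : X

variable (S : CrossedSystem X N)

theorem act_map_one (x : X) : S.act x 1 = 1 := by
  have h := S.act_mul x 1 1
  rw [one_mul] at h
  exact left_eq_mul.mp h

instance : Mul S.Product :=
  ⟨fun a b => ⟨a.fst * S.act a.snd b.fst * S.θ a.snd b.snd, a.snd * b.snd⟩⟩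

instance : One S.Product := ⟨⟨1, 1⟩⟩

instance : Inv S.Product :=
  ⟨fun a => ⟨(S.θ a.snd⁻¹ a.snd)⁻¹ * (S.act a.snd⁻¹ a.fst)⁻¹, a.snd⁻¹⟩⟩

theorem mul_def (a b : S.Product) :
    a * b = ⟨a.fst * S.act a.snd b.fst * S.θ a.snd b.snd, a.snd * b.snd⟩ := rfl

theorem one_def : (1 : S.Product) = ⟨1, 1⟩ := rfl

theorem inv_def (a : S.Product) :
    a⁻¹ = ⟨(S.θ a.snd⁻¹ a.snd)⁻¹ * (S.act a.snd⁻¹ a.fst)⁻¹, a.snd⁻¹⟩ := rfl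

instance : Group S.Product :=
  Group.ofLeftAxioms
    (by
      rintro ⟨a, x⟩ ⟨b, y⟩ ⟨c, z⟩
      simp only [mul_def, Product.mk.injEq, mul_assoc, and_true, S.act_mul]
      congr 2
      rw [← S.θ_assoc, ← mul_assoc, S.θ_act, mul_assoc])
    (by
      rintro ⟨a, x⟩
      simp [mul_def, one_def, S.act_one, S.θ_one_left])
    (by
      rintro ⟨a, x⟩
      have h := S.θ_act x⁻¹ x
      have h0 := S.act_mul x⁻¹
      simp only [mul_def, one_def, inv_def, Product.mk.injEq, inv_mul_cancel, and_true]
      group)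

/-- The exact sequence `1 → N → N #_θ X → X → 1`, `n ↦ (n, 1)`, `(n, x) ↦ x`. -/
def extension : GroupExtension N S.Product X where
  inl :=
    { toFun := fun n => ⟨n, 1⟩
      map_one' := rfl
      map_mul' := fun a b => by simp [mul_def, S.act_one, S.θ_one_left] }
  rightHom :=
    { toFun := fun a => a.snd
      map_one' := rfl
      map_mul' := fun _ _ => rfl }
  inl_injective := fun a b h => congrArg Product.fst h
  range_inl_eq_ker_rightHom := by
    ext ⟨n, x⟩
    constructor
    · rintro ⟨m, hm⟩
      exact (congrArg Product.snd hm).symm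
    · intro h
      exact ⟨n, Product.ext rfl (Eq.symm h)⟩
  rightHom_surjective := fun x => ⟨⟨1, x⟩, rfl⟩

/-- The restriction of a crossed system along a homomorphism `Y → X` (below: the inclusion of a
group `Y` into `X`), so that `N #_θ Y ⊆ N #_θ X`. -/
def comap (f : Y →* X) : CrossedSystem Y N where
  act y n := S.act (f y) n
  θ y z := S.θ (f y) (f z)
  act_mul _ _ _ := S.act_mul _ _ _
  θ_act _ _ _ := by rw [map_mul]; exact S.θ_act _ _ _
  θ_assoc _ _ _ := by simp only [map_mul]; exact S.θ_assoc _ _ _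
  θ_one_right _ := by rw [map_one]; exact S.θ_one_right _
  θ_one_left _ := by rw [map_one]; exact S.θ_one_left _
  act_one _ := by rw [map_one]; exact S.act_one _

/-- Transport of a crossed system along an isomorphism of the normal subgroup. -/
def congr (e : M ≃* N) : CrossedSystem X M where
  act x m := e.symm (S.act x (e m))
  θ x y := e.symm (S.θ x y)
  act_mul _ _ _ := by simp [S.act_mul]
  θ_act _ _ _ := by simp [← map_mul, S.θ_act]
  θ_assoc _ _ _ := by simp [← map_mul, S.θ_assoc]
  θ_one_right _ := by simp [S.θ_one_right]
  θ_one_left _ := by simp [S.θ_one_left]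
  act_one _ := by simp [S.act_one]

end CrossedSystem

/-! ### Twisted group algebras -/

section Twisted

variable {V : Type*} [AddCommGroup V]

/-- `Aut(V)`, the group of automorphisms of the abelian group `V` (written as `ℤ`-linear
automorphisms, the product being composition). -/
abbrev AutGrp (V : Type*) [AddCommGroup V] : Type _ := V ≃ₗ[ℤ] V

/-- Normalized 2-cocycles on the abelian group `V` with values in the trivial module `ℂˣ`. -/
structure Cocycle (V : Type*) [AddCommGroup V] where
  toFun : V → V → ℂˣ
  zero_left : ∀ x, toFun 0 x = 1
  zero_right : ∀ x, toFun x 0 = 1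
  cocycle : ∀ x y z, toFun x y * toFun (x + y) z = toFun y z * toFun x (y + z)

namespace Cocycle

instance : CoeFun (Cocycle V) (fun _ => V → V → ℂˣ) := ⟨Cocycle.toFun⟩

/-- `Alt(α)(x, y) = α(x, y) / α(y, x)`. -/
def alt (α : Cocycle V) (x y : V) : ℂˣ := α x y / α y x

/-- `α` is nondegenerate if `0` is the only `α`-regular element. -/
def Nondegenerate (α : Cocycle V) : Prop := ∀ x, (∀ y, α x y = α y x) → x = 0

theorem alt_add_right (α : Cocycle V) (v x y : V) :
    α.alt v (x + y) = α.alt v x * α.alt v y := by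
  have h1 := α.cocycle v x y
  have h2 := α.cocycle x y v
  have h3 := α.cocycle x v y
  rw [add_comm x v] at h3
  rw [add_comm y v] at h2
  simp only [alt]
  rw [div_mul_div_comm, div_eq_div_iff_mul_eq_mul]
  apply mul_left_cancel (a := α x y * α (v + x) y)
  calc α x y * α (v + x) y * (α v (x + y) * (α x v * α y v))
      = (α x y * α v (x + y)) * (α x v * α (v + x) y) * α y v := by
        simp only [mul_assoc, mul_comm, mul_left_comm]
    _ = (α v x * α (v + x) y) * (α v y * α x (v + y)) * α y v := by rw [h1, h3]
    _ = (α v x * α (v + x) y) * α v y * (α y v * α x (v + y)) := by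
        simp only [mul_assoc, mul_comm, mul_left_comm]
    _ = (α v x * α (v + x) y) * α v y * (α x y * α (x + y) v) := by rw [h2]
    _ = _ := by simp only [mul_assoc, mul_comm, mul_left_comm]

/-- The twisted group algebra `ℂ_α[V]`, with basis `u_x`, `x ∈ V`. -/
def Alg (_α : Cocycle V) : Type _ := V →₀ ℂ

variable (α : Cocycle V)

instance : AddCommGroup α.Alg := inferInstanceAs (AddCommGroup (V →₀ ℂ))

instance : Module ℂ α.Alg := inferInstanceAs (Module ℂ (V →₀ ℂ))

/-- The basis of `ℂ_α[V]`. -/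
def basis : Module.Basis V ℂ α.Alg := Module.Basis.ofRepr (LinearEquiv.refl ℂ (V →₀ ℂ))

/-- The basis element `u_x`. -/
def u (x : V) : α.Alg := α.basis x

/-- The bilinear multiplication with `u_x u_y = α(x, y) u_{x + y}`. -/
def mulLin : α.Alg →ₗ[ℂ] α.Alg →ₗ[ℂ] α.Alg :=
  α.basis.constr ℂ fun x => α.basis.constr ℂ fun y => (α x y : ℂ) • α.u (x + y)

theorem mulLin_u (x y : V) : α.mulLin (α.u x) (α.u y) = (α x y : ℂ) • α.u (x + y) := by
  simp [mulLin, u]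

instance : Mul α.Alg := ⟨fun a b => α.mulLin a b⟩

instance : One α.Alg := ⟨α.u 0⟩

theorem mul_eq (a b : α.Alg) : a * b = α.mulLin a b := rfl

theorem one_eq : (1 : α.Alg) = α.u 0 := rfl

theorem u_mul_u (x y : V) : α.u x * α.u y = (α x y : ℂ) • α.u (x + y) := α.mulLin_u x y

theorem span_u : Submodule.span ℂ (Set.range α.u) = ⊤ := α.basis.span_eq

@[elab_as_elim]
theorem induction {p : α.Alg → Prop} (hu : ∀ x, p (α.u x)) (hz : p 0)
    (hadd : ∀ a b, p a → p b → p (a + b)) (hsmul : ∀ (c : ℂ) a, p a → p (c • a))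
    (a : α.Alg) : p a := by
  have ha : a ∈ Submodule.span ℂ (Set.range α.u) := by rw [span_u]; trivial
  induction ha using Submodule.span_induction with
  | mem x hx => obtain ⟨y, rfl⟩ := hx; exact hu y
  | zero => exact hz
  | add a b _ _ h1 h2 => exact hadd a b h1 h2
  | smul c a _ h => exact hsmul c a h

theorem one_mul_aux (a : α.Alg) : 1 * a = a := by
  rw [mul_eq, one_eq]
  refine α.induction (fun x => ?_) ?_ (fun a b ha hb => ?_) (fun c a ha => ?_) a
  · simp [mulLin_u, α.zero_left]
  · simp
  · rw [map_add, ha, hb]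
  · rw [map_smul, ha]

theorem mul_one_aux (a : α.Alg) : a * 1 = a := by
  rw [mul_eq, one_eq]
  refine α.induction (fun x => ?_) ?_ (fun a b ha hb => ?_) (fun c a ha => ?_) a
  · simp [mulLin_u, α.zero_right]
  · simp
  · rw [map_add, LinearMap.add_apply, ha, hb]
  · rw [map_smul, LinearMap.smul_apply, ha]

theorem mul_assoc_aux (a b c : α.Alg) : a * b * c = a * (b * c) := by
  simp only [mul_eq]
  refine α.induction (fun x => ?_) ?_ (fun a a' ha hb => ?_) (fun r a ha => ?_) a
  · refine α.induction (fun y => ?_) ?_ (fun a a' ha hb => ?_) (fun r a ha => ?_) b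
    · refine α.induction (fun z => ?_) ?_ (fun a a' ha hb => ?_) (fun r a ha => ?_) c
      · simp only [mulLin_u, map_smul, LinearMap.smul_apply, smul_smul, add_assoc,
          ← Units.val_mul, α.cocycle]
      · simp
      · simp only [map_add, ha, hb]
      · simp only [map_smul, ha]
    · simp
    · simp only [map_add, LinearMap.add_apply, ha, hb]
    · simp only [map_smul, LinearMap.smul_apply, ha]
  · simp
  · simp only [map_add, LinearMap.add_apply, ha, hb]
  · simp only [map_smul, LinearMap.smul_apply, ha]

instance : Ring α.Alg :=
  { (inferInstance : AddCommGroup α.Alg) with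
    mul := (· * ·)
    one := 1
    one_mul := α.one_mul_aux
    mul_one := α.mul_one_aux
    mul_assoc := α.mul_assoc_aux
    zero_mul := fun a => by simp [mul_eq]
    mul_zero := fun a => by simp [mul_eq]
    left_distrib := fun a b c => by simp [mul_eq]
    right_distrib := fun a b c => by simp [mul_eq] }

instance : Algebra ℂ α.Alg :=
  Algebra.ofModule (fun r a b => by simp [mul_eq]) (fun r a b => by simp [mul_eq])

/-- The action of `V` on the `V`-Galois algebra `ℂ_α[V]`: `v · u_x = Alt(α)(v, x) u_x`
(this is conjugation by `u_v`). -/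
def galois (v : V) : α.Alg →ₗ[ℂ] α.Alg :=
  α.basis.constr ℂ fun x => (α.alt v x : ℂ) • α.u x

theorem galois_u (v x : V) : α.galois v (α.u x) = (α.alt v x : ℂ) • α.u x := by
  simp [galois, u]

theorem linearMap_ext {W : Type*} [AddCommGroup W] [Module ℂ W] {f g : α.Alg →ₗ[ℂ] W}
    (h : ∀ x, f (α.u x) = g (α.u x)) : f = g := α.basis.ext h

theorem algEquiv_ext {f g : α.Alg ≃ₐ[ℂ] α.Alg} (h : ∀ x, f (α.u x) = g (α.u x)) :
    f = g := by
  ext a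
  exact LinearMap.congr_fun (α.linearMap_ext (f := f.toLinearMap) (g := g.toLinearMap) h) a

/-- `Aut_V(A)`, the group of `V`-equivariant algebra automorphisms of `A = ℂ_α[V]`. -/
def autV : Subgroup (α.Alg ≃ₐ[ℂ] α.Alg) where
  carrier := {f | ∀ v a, f (α.galois v a) = α.galois v (f a)}
  mul_mem' := fun {f g} hf hg v a => by
    rw [AlgEquiv.mul_apply, hg, hf, AlgEquiv.mul_apply]
  one_mem' := fun _ _ => rfl
  inv_mem' := fun {f} hf v a => by
    apply f.injective
    rw [hf]
    simp [AlgEquiv.aut_inv]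

theorem apply_inv (g : AutGrp V) (x : V) : g (g⁻¹ x) = x := LinearEquiv.apply_symm_apply g x

theorem inv_apply (g : AutGrp V) (x : V) : g⁻¹ (g x) = x := LinearEquiv.symm_apply_apply g x

/-- The linear map `u_x ↦ η(x) u_{g x}`. -/
def monomialLin (g : AutGrp V) (η : V → ℂˣ) : α.Alg →ₗ[ℂ] α.Alg :=
  α.basis.constr ℂ fun x => (η x : ℂ) • α.u (g x)

theorem monomialLin_u (g : AutGrp V) (η : V → ℂˣ) (x : V) :
    α.monomialLin g η (α.u x) = (η x : ℂ) • α.u (g x) := by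
  simp [monomialLin, u]

/-- The algebra endomorphism `u_x ↦ η(x) u_{g x}`. -/
def monomialHom (g : AutGrp V) (η : V → ℂˣ)
    (h : ∀ x y, α (g x) (g y) * (η x * η y) = α x y * η (x + y)) :
    α.Alg →ₐ[ℂ] α.Alg :=
  AlgHom.ofLinearMap (α.monomialLin g η)
    (by
      have h0 : η 0 = 1 := by
        have := h 0 0
        simpa [α.zero_left] using this
      rw [one_eq, monomialLin_u, h0, map_zero]
      simp)
    (by
      intro a b
      refine α.induction (fun x => ?_) ?_ (fun a a' ha hb => ?_) (fun r a ha => ?_) a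
      · refine α.induction (fun y => ?_) ?_ (fun a a' ha hb => ?_) (fun r a ha => ?_) b
        · rw [u_mul_u, map_smul, monomialLin_u, monomialLin_u, monomialLin_u, smul_mul_smul_comm,
            u_mul_u, smul_smul, smul_smul, map_add, ← Units.val_mul, ← Units.val_mul,
            ← Units.val_mul, ← h, mul_comm]
        · simp
        · simp only [mul_add, map_add, ha, hb]
        · simp only [mul_smul_comm, map_smul, ha]
      · simp
      · simp only [add_mul, map_add, ha, hb]
      · simp only [smul_mul_assoc, map_smul, ha])

/-- The algebra automorphism `u_x ↦ η(x) u_{g x}` of `ℂ_α[V]`; the hypothesis says that `α^g / α`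
is the coboundary of `η` (or of `η⁻¹`, depending on the sign convention for coboundaries). -/
def monomial (g : AutGrp V) (η : V → ℂˣ)
    (h : ∀ x y, α (g x) (g y) * (η x * η y) = α x y * η (x + y)) :
    α.Alg ≃ₐ[ℂ] α.Alg :=
  AlgEquiv.ofAlgHom (α.monomialHom g η h)
    (α.monomialHom g⁻¹ (fun x => (η (g⁻¹ x))⁻¹) (by
      intro x y
      have := h (g⁻¹ x) (g⁻¹ y)
      simp only [← map_add, apply_inv] at this
      rw [← mul_inv, mul_inv_eq_iff_eq_mul, mul_right_comm, this, mul_inv_cancel_right]))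
    (by
      apply AlgHom.toLinearMap_injective
      refine α.linearMap_ext fun x => ?_
      simp [monomialHom, monomialLin_u, smul_smul])
    (by
      apply AlgHom.toLinearMap_injective
      refine α.linearMap_ext fun x => ?_
      simp [monomialHom, monomialLin_u, smul_smul, inv_apply])

theorem monomial_u (g : AutGrp V) (η : V → ℂˣ)
    (h : ∀ x y, α (g x) (g y) * (η x * η y) = α x y * η (x + y)) (x : V) :
    α.monomial g η h (α.u x) = (η x : ℂ) • α.u (g x) := α.monomialLin_u g η x

/-- An element `χ` of the dual group `V̂ = Hom(V, ℂˣ)` acts on `ℂ_α[V]` by `u_x ↦ χ(x) u_x`. -/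
def diag (χ : AddChar V ℂˣ) : α.Alg ≃ₐ[ℂ] α.Alg :=
  α.monomial 1 χ (fun x y => by simp [AddChar.map_add_eq_mul])

theorem diag_u (χ : AddChar V ℂˣ) (x : V) : α.diag χ (α.u x) = (χ x : ℂ) • α.u x :=
  α.monomialLin_u 1 χ x

/-- The homomorphism `V̂ → Aut_V(A)`. -/
def dualHom : AddChar V ℂˣ →* α.autV where
  toFun χ := ⟨α.diag χ, by
    intro v a
    refine α.induction (fun x => ?_) ?_ (fun a a' ha hb => ?_) (fun r a ha => ?_) a
    · rw [galois_u, map_smul, diag_u, map_smul, galois_u, smul_comm]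
    · simp
    · simp only [map_add, ha, hb]
    · simp only [map_smul, ha]⟩
  map_one' := by
    apply Subtype.ext
    apply α.algEquiv_ext
    intro x
    simp [diag_u]
  map_mul' χ ψ := by
    apply Subtype.ext
    apply α.algEquiv_ext
    intro x
    simp [diag_u, smul_smul, mul_comm]

theorem u_ne_zero (x : V) : α.u x ≠ 0 := α.basis.ne_zero x

theorem smul_u_injective (x : V) {c d : ℂ} (h : c • α.u x = d • α.u x) : c = d :=
  smul_left_injective ℂ (α.u_ne_zero x) h

theorem repr_galois (v : V) (a : α.Alg) (y : V) :
    α.basis.repr (α.galois v a) y = (α.alt v y : ℂ) * α.basis.repr a y := by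
  refine α.induction (fun x => ?_) ?_ (fun a a' ha hb => ?_) (fun r a ha => ?_) a
  · rw [galois_u, map_smul, u, Module.Basis.repr_self, Finsupp.smul_apply, smul_eq_mul]
    by_cases h : x = y
    · rw [h]
    · simp [Finsupp.single_eq_of_ne' h]
  · simp
  · simp only [map_add, Finsupp.add_apply, ha, hb, mul_add]
  · simp only [map_smul, Finsupp.smul_apply, smul_eq_mul, ha]
    ring

theorem dualHom_injective : Function.Injective α.dualHom := by
  intro χ ψ h
  ext x
  have h1 : α.diag χ (α.u x) = α.diag ψ (α.u x) := by
    rw [show α.diag χ = α.diag ψ from congrArg Subtype.val h]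
  rw [diag_u, diag_u] at h1
  exact α.smul_u_injective x h1

theorem dualHom_surjective (hα : α.Nondegenerate) : Function.Surjective α.dualHom := by
  rintro ⟨f, hf⟩
  have key : ∀ x, ∃ c : ℂˣ, f (α.u x) = (c : ℂ) • α.u x := by
    intro x
    have h1 : f (α.u x) = (α.basis.repr (f (α.u x)) x) • α.u x := by
      apply α.basis.repr.injective
      ext y
      rw [map_smul, u, Module.Basis.repr_self, Finsupp.smul_apply, smul_eq_mul]
      by_cases h : x = y
      · rw [h]; simp
      · rw [Finsupp.single_eq_of_ne' h, mul_zero]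
        by_contra hne
        apply h
        have h2 : ∀ v, α.alt v x = α.alt v y := by
          intro v
          have h3 := hf v (α.u x)
          rw [galois_u, map_smul] at h3
          have h4 := congrArg (fun a => α.basis.repr a y) h3
          simp only [repr_galois, map_smul, Finsupp.smul_apply, smul_eq_mul] at h4
          exact Units.ext (mul_right_cancel₀ hne h4)
        have h5 : x - y = 0 := by
          apply hα
          intro v
          have h6 : α.alt v (x - y) = 1 := by
            have := α.alt_add_right v (x - y) y
            rw [sub_add_cancel, h2] at this
            exact right_eq_mul.mp this
          exact (div_eq_one.mp h6).symm
        exact sub_eq_zero.mp h5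
    have h0 : α.basis.repr (f (α.u x)) x ≠ 0 := by
      intro h0
      rw [h0, zero_smul] at h1
      exact α.u_ne_zero x (f.injective (h1.trans (map_zero f).symm))
    exact ⟨Units.mk0 _ h0, h1⟩
  choose c hc using key
  refine ⟨⟨c, ?_, ?_⟩, ?_⟩
  · have h1 := hc 0
    rw [← one_eq, map_one] at h1
    apply Units.ext
    apply α.smul_u_injective 0
    rw [← one_eq, ← h1]
    simp
  · intro x y
    have h1 : f (α.u x * α.u y) = f (α.u x) * f (α.u y) := map_mul f _ _
    rw [u_mul_u, map_smul, hc, hc, hc, smul_mul_smul_comm, u_mul_u, smul_smul, smul_smul] at h1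
    have h2 := α.smul_u_injective _ h1
    rw [mul_comm] at h2
    exact Units.ext (mul_right_cancel₀ (α x y).ne_zero (by simpa using h2))
  · apply Subtype.ext
    apply α.algEquiv_ext
    intro x
    exact (α.diag_u _ x).trans (hc x).symm

/-- `V̂ ≅ Aut_V(ℂ_α[V])` for nondegenerate `α`. -/
def dualEquiv (hα : α.Nondegenerate) : AddChar V ℂˣ ≃* α.autV :=
  MulEquiv.ofBijective α.dualHom ⟨α.dualHom_injective, α.dualHom_surjective hα⟩

/-- `f : A → A^{(g)}` is an isomorphism of `V`-algebras, where `A = ℂ_α[V]` and `A^{(g)}` is the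
algebra `A` on which `v ∈ V` acts as `g(v)` acts on `A`. -/
def IsTwistedIso (g : AutGrp V) (f : α.Alg ≃ₐ[ℂ] α.Alg) : Prop :=
  ∀ v a, f (α.galois v a) = α.galois (g v) (f a)

variable {α}

theorem IsTwistedIso.mul {g h : AutGrp V} {e f : α.Alg ≃ₐ[ℂ] α.Alg}
    (he : α.IsTwistedIso g e) (hf : α.IsTwistedIso h f) : α.IsTwistedIso (g * h) (e * f) := by
  intro v a
  rw [AlgEquiv.mul_apply, hf, he, AlgEquiv.mul_apply]
  rfl

theorem IsTwistedIso.inv {g : AutGrp V} {f : α.Alg ≃ₐ[ℂ] α.Alg}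
    (hf : α.IsTwistedIso g f) : α.IsTwistedIso g⁻¹ f⁻¹ := by
  intro v a
  apply f.injective
  rw [hf, apply_inv]
  simp [AlgEquiv.aut_inv]

theorem isTwistedIso_one_iff {f : α.Alg ≃ₐ[ℂ] α.Alg} :
    α.IsTwistedIso 1 f ↔ f ∈ α.autV := Iff.rfl

end Cocycle

/-- A choice, for every `g` in a group `H` of automorphisms of `V`, of a cochain `η_g` such that
`α_g : u_x ↦ η_g(x) u_{g x}` is an algebra automorphism of `ℂ_α[V]`, with `α_1 = id`. -/
structure LiftFamily (α : Cocycle V) (H : Subgroup (AutGrp V)) where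
  η : H → V → ℂˣ
  coboundary : ∀ (g : H) (x y : V),
    α (g.1 x) (g.1 y) * (η g x * η g y) = α x y * η g (x + y)
  η_one : ∀ x, η 1 x = 1

namespace LiftFamily

variable {α : Cocycle V} {H : Subgroup (AutGrp V)} (L : LiftFamily α H)

/-- The algebra automorphism `α_g : u_x ↦ η_g(x) u_{g x}`. -/
def lift (g : H) : α.Alg ≃ₐ[ℂ] α.Alg := α.monomial g.1 (L.η g) (L.coboundary g)

theorem lift_u (g : H) (x : V) : L.lift g (α.u x) = (L.η g x : ℂ) • α.u (g.1 x) :=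
  α.monomialLin_u g.1 (L.η g) x

theorem lift_one : L.lift 1 = 1 := by
  apply α.algEquiv_ext
  intro x
  rw [lift_u, L.η_one]
  simp

theorem alt_map (L : LiftFamily α H) (g : H) (x y : V) :
    α.alt (g.1 x) (g.1 y) = α.alt x y := by
  have h1 := L.coboundary g x y
  have h2 := L.coboundary g y x
  rw [add_comm y x, mul_comm (L.η g y)] at h2
  rw [← eq_mul_inv_iff_mul_eq] at h1 h2
  simp only [Cocycle.alt]
  rw [h1, h2, mul_div_mul_right_eq_div, mul_div_mul_right_eq_div]

theorem isTwistedIso_lift (g : H) : α.IsTwistedIso g.1 (L.lift g) := by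
  intro v a
  refine α.induction (fun x => ?_) ?_ (fun a a' ha hb => ?_) (fun r a ha => ?_) a
  · rw [α.galois_u, map_smul, lift_u, map_smul, α.galois_u, L.alt_map, smul_comm]
  · simp
  · simp only [map_add, ha, hb]
  · simp only [map_smul, ha]

/-- The crossed system of `H` over `Aut_V(A)`, `A = ℂ_α[V]`, given by `ᵍf = α_g f α_g⁻¹` and
`θ(g, h) = α_g α_h α_{gh}⁻¹`; the crossed product acts on `A` by `(f, g) · a = f(α_g(a))`. -/
def autSystem : CrossedSystem H α.autV where
  act g f := ⟨L.lift g * f.1 * (L.lift g)⁻¹, by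
    have h := ((L.isTwistedIso_lift g).mul (Cocycle.isTwistedIso_one_iff.mpr f.2)).mul
      (L.isTwistedIso_lift g).inv
    rwa [mul_one, mul_inv_cancel] at h⟩
  θ g h := ⟨L.lift g * L.lift h * (L.lift (g * h))⁻¹, by
    have h := ((L.isTwistedIso_lift g).mul (L.isTwistedIso_lift h)).mul
      (L.isTwistedIso_lift (g * h)).inv
    rwa [Subgroup.coe_mul, mul_inv_cancel] at h⟩
  act_mul g f e := Subtype.ext (by simp only [Subgroup.coe_mul]; group)
  θ_act g h f := Subtype.ext (by simp only [Subgroup.coe_mul]; group)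
  θ_assoc g h i := Subtype.ext (by simp only [Subgroup.coe_mul, mul_assoc]; group)
  θ_one_right g := Subtype.ext (by simp [lift_one])
  θ_one_left g := Subtype.ext (by simp [lift_one])
  act_one f := Subtype.ext (by simp [lift_one])

/-- The same crossed system, over `V̂ = Aut_V(A)`. -/
def weilSystem (hα : α.Nondegenerate) : CrossedSystem H (AddChar V ℂˣ) :=
  L.autSystem.congr (α.dualEquiv hα)

end LiftFamily

/-! ### Symplectic and quadratic modules -/

/-- The group `Sp(V, ω)` of a bicharacter `ω`. -/
def Sp (ω : V → V → ℂˣ) : Subgroup (AutGrp V) where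
  carrier := {g | ∀ x y, ω (g x) (g y) = ω x y}
  mul_mem' := fun {g h} hg hh x y => (hg (h x) (h y)).trans (hh x y)
  one_mem' := fun _ _ => rfl
  inv_mem' := fun {g} hg x y => by
    have h := hg (g⁻¹ x) (g⁻¹ y)
    rw [Cocycle.apply_inv, Cocycle.apply_inv] at h
    exact h.symm

/-- The group `O(V, Q)` of a quadratic form `Q : V → ℂˣ`. -/
def Orth (Q : V → ℂˣ) : Subgroup (AutGrp V) where
  carrier := {g | ∀ x, Q (g x) = Q x}
  mul_mem' := fun {g h} hg hh x => (hg (h x)).trans (hh x)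
  one_mem' := fun _ => rfl
  inv_mem' := fun {g} hg x => by
    have h := hg (g⁻¹ x)
    rw [Cocycle.apply_inv] at h
    exact h.symm

/-- `b : V × V → ℂˣ` is a bicharacter. -/
structure IsBicharacter (b : V → V → ℂˣ) : Prop where
  add_left : ∀ x y z, b (x + y) z = b x z * b y z
  add_right : ∀ x y z, b x (y + z) = b x y * b x z

/-- A bicharacter, regarded as a 2-cocycle. -/
def IsBicharacter.toCocycle {b : V → V → ℂˣ} (hb : IsBicharacter b) : Cocycle V where
  toFun := b
  zero_left x := by
    have h := hb.add_left 0 0 x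
    rw [add_zero] at h
    exact left_eq_mul.mp h
  zero_right x := by
    have h := hb.add_right x 0 0
    rw [add_zero] at h
    exact left_eq_mul.mp h
  cocycle x y z := by
    rw [hb.add_left, hb.add_right, ← mul_assoc, mul_comm (b x y), mul_comm (b x z), mul_right_comm]
    ac_rfl

/-- The group `C₀¹(V, μ_n)` of (normalized) maps `η : V → μ_n` whose coboundary is a bicharacter and
which satisfy `η(x + x) = η(x)²`. -/
structure IsC01 (n : ℕ) (η : V → ℂˣ) : Prop where
  zero : η 0 = 1
  pow : ∀ x, η x ^ n = 1
  bichar : IsBicharacter fun x y => η x * η y / η (x + y)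
  double : ∀ x, η (x + x) = η x ^ 2

/-- The choices that enter the affine pseudo-symplectic group `V̂ #_θ Sp(V, ω)` of `(V, ω)`:
a 2-cocycle `α` with `Alt(α) = ω`, and the cochains `η_g`, `g ∈ Sp(V, ω)`. -/
structure APsData (ω : V → V → ℂˣ) where
  α : Cocycle V
  alt_eq : ∀ x y, α.alt x y = ω x y
  lifts : LiftFamily α (Sp ω)

/-- The choices that enter the pseudo-symplectic group `V̂ #_θ O(V, Q)` of a quadratic module
`(V, Q)` of exponent `n`: a bicharacter `b` with `b(x, x) = Q(x)`, and the cochains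
`η_g ∈ C₀¹(V, μ_n)`, `g ∈ O(V, Q)`. -/
structure PsData (n : ℕ) (Q : V → ℂˣ) where
  b : V → V → ℂˣ
  bichar : IsBicharacter b
  b_self : ∀ x, b x x = Q x
  lifts : LiftFamily bichar.toCocycle (Orth Q)
  isC01 : ∀ g, IsC01 n (lifts.η g)

end Twisted

/-! ### Quadratic spaces over finite fields of characteristic two -/

section Quadratic

variable {k V : Type*} [Field k] [CharP k 2] [AddCommGroup V] [Module k V]

/-- The character `t ↦ exp(2πi Tr(t) / 2)` of `k`, where `Tr : k → 𝔽₂` is the trace. -/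
def traceChar (k : Type*) [Field k] [CharP k 2] : AddChar k ℂˣ :=
  letI := ZMod.algebra k 2
  Circle.toUnits.compAddChar
    ((ZMod.toCircle (N := 2)).compAddMonoidHom (Algebra.trace (ZMod 2) k).toAddMonoidHom)

/-- The quadratic form `q̂(v) = exp(2πi Tr(q(v)) / 2)` on the abelian group `V`. -/
def qHat (q : QuadraticForm k V) (x : V) : ℂˣ := traceChar k (q x)

/-- The skew-symmetric form `ω(v, w) = exp(2πi Tr(B(v, w)) / 2)` on the abelian group `V`, where
`B(v, w) = q(v + w) - q(v) - q(w)`. -/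
def omega (q : QuadraticForm k V) (x y : V) : ℂˣ := traceChar k (QuadraticMap.polar q x y)

end Quadratic

section Linear

variable {k V : Type*} [Field k] [AddCommGroup V] [Module k V] (q : QuadraticForm k V)

/-- The linear symplectic group `Sp_k(V)` of the bilinear form associated with `q`. -/
def SpLin : Subgroup (V ≃ₗ[k] V) where
  carrier := {g | ∀ x y, QuadraticMap.polar q (g x) (g y) = QuadraticMap.polar q x y}
  mul_mem' := fun {g h} hg hh x y => (hg (h x) (h y)).trans (hh x y)
  one_mem' := fun _ _ => rfl
  inv_mem' := fun {g} hg x y => by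
    have h := hg (g.symm x) (g.symm y)
    rw [LinearEquiv.apply_symm_apply, LinearEquiv.apply_symm_apply] at h
    exact h.symm

/-- The linear orthogonal group `O_k(V, q)`. -/
def OrthLin : Subgroup (V ≃ₗ[k] V) where
  carrier := {g | ∀ x, q (g x) = q x}
  mul_mem' := fun {g h} hg hh x => (hg (h x)).trans (hh x)
  one_mem' := fun _ => rfl
  inv_mem' := fun {g} hg x => by
    have h := hg (g.symm x)
    rw [LinearEquiv.apply_symm_apply] at h
    exact h.symm

variable {q}

/-- The automorphism of the Clifford algebra of `q` induced by `g ∈ O_k(V, q)`. -/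
def cliffordMap (g : OrthLin q) : CliffordAlgebra q →ₐ[k] CliffordAlgebra q :=
  CliffordAlgebra.map (⟨g.1.toLinearMap, g.2⟩ : q →qᵢ q)

theorem cliffordMap_mul (g h : OrthLin q) :
    cliffordMap (g * h) = (cliffordMap g).comp (cliffordMap h) := by
  rw [cliffordMap, cliffordMap, cliffordMap, CliffordAlgebra.map_comp_map]
  rfl

theorem cliffordMap_one : cliffordMap (1 : OrthLin q) = AlgHom.id k _ :=
  CliffordAlgebra.map_id q

open Classical in
/-- The Dickson invariant of `g ∈ O_k(V, q)`: it is `0` if `g` acts trivially on the center of the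
even Clifford algebra (a quadratic étale algebra over `k` if the polar form of `q` is
nondegenerate and `dim V > 0` is even), and `1` otherwise. -/
def dickson (g : OrthLin q) : ZMod 2 :=
  if ∀ z ∈ CliffordAlgebra.even q, (∀ y ∈ CliffordAlgebra.even q, y * z = z * y) →
    cliffordMap g z = z then 0 else 1

theorem dickson_eq_zero_iff (g : OrthLin q) :
    dickson g = 0 ↔ ∀ z ∈ CliffordAlgebra.even q,
      (∀ y ∈ CliffordAlgebra.even q, y * z = z * y) → cliffordMap g z = z := by
  unfold dickson
  split_ifs with h
  · exact iff_of_true rfl h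
  · exact iff_of_false one_ne_zero h

variable (q)

/-- `Ω_k(V, q)`, the subgroup of `O_k(V, q)` of the elements with Dickson invariant zero. -/
def OmegaLin : Subgroup (OrthLin q) where
  carrier := {g | dickson g = 0}
  mul_mem' := fun {g h} hg hh => by
    rw [Set.mem_ofPred_eq, dickson_eq_zero_iff] at *
    intro z hz hc
    rw [cliffordMap_mul, AlgHom.comp_apply, hh z hz hc, hg z hz hc]
  one_mem' := by
    rw [Set.mem_ofPred_eq, dickson_eq_zero_iff]
    intro z _ _
    rw [cliffordMap_one, AlgHom.id_apply]
  inv_mem' := fun {g} hg => by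
    rw [Set.mem_ofPred_eq, dickson_eq_zero_iff] at *
    intro z hz hc
    conv_lhs => rw [← hg z hz hc]
    rw [← AlgHom.comp_apply, ← cliffordMap_mul, inv_mul_cancel, cliffordMap_one, AlgHom.id_apply]

end Linear

section Extensions

variable {k V : Type*} [Field k] [CharP k 2] [AddCommGroup V] [Module k V]
  (q : QuadraticForm k V)

/-- The inclusion `Sp_k(V) → Sp(V, ω)`. -/
def spIncl : SpLin q →* Sp (omega q) where
  toFun g := ⟨g.1.restrictScalars ℤ, fun x y => congrArg (traceChar k) (g.2 x y)⟩
  map_one' := rfl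
  map_mul' _ _ := rfl

/-- The inclusion `O_k(V, q) → O(V, q̂)`. -/
def orthIncl : OrthLin q →* Orth (qHat q) where
  toFun g := ⟨g.1.restrictScalars ℤ, fun x => congrArg (traceChar k) (g.2 x)⟩
  map_one' := rfl
  map_mul' _ _ := rfl

variable {q}

theorem traceChar_eq_one_iff (t : k) :
    letI := ZMod.algebra k 2
    traceChar k t = 1 ↔ Algebra.trace (ZMod 2) k t = 0 := by
  let _ := ZMod.algebra k 2
  constructor
  · intro h
    apply ZMod.injective_toCircle
    rw [AddChar.map_zero_eq_one]
    apply Circle.ext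
    exact congrArg Units.val h
  · intro h
    apply Units.ext
    change ((ZMod.toCircle (Algebra.trace (ZMod 2) k t) : Circle) : ℂ) = 1
    rw [h, AddChar.map_zero_eq_one]
    rfl

theorem omega_nondegenerate [Finite k] (hq : (QuadraticMap.polarBilin q).Nondegenerate) (x : V)
    (h : ∀ y, omega q x y = 1) : x = 0 := by
  let _ := ZMod.algebra k 2
  apply hq.1
  intro y
  by_contra hne
  obtain ⟨c, hc⟩ := Algebra.trace_surjective (ZMod 2) k 1
  have h1 := (traceChar_eq_one_iff _).mp (h ((c / QuadraticMap.polar q x y) • y))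
  have h2 : QuadraticMap.polar q x y ≠ 0 := hne
  rw [QuadraticMap.polar_smul_right, smul_eq_mul, div_mul_cancel₀ _ h2, hc] at h1
  exact one_ne_zero h1

theorem APsData.nondegenerate [Finite k] (hq : (QuadraticMap.polarBilin q).Nondegenerate)
    (D : APsData (omega q)) : D.α.Nondegenerate := by
  intro x h
  apply omega_nondegenerate hq
  intro y
  rw [← D.alt_eq, Cocycle.alt, h, div_self']

theorem PsData.alt_eq (D : PsData 2 (qHat q)) (x y : V) :
    D.bichar.toCocycle.alt x y = omega q x y := by
  have h2 : D.b y x * D.b y x = 1 := by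
    have h0 : y + y = 0 := by
      rw [← two_smul k y, CharTwo.two_eq_zero, zero_smul]
    rw [← D.bichar.add_left, h0]
    exact D.bichar.toCocycle.zero_left x
  have h3 := D.b_self (x + y)
  rw [D.bichar.add_left, D.bichar.add_right, D.bichar.add_right, D.b_self, D.b_self] at h3
  have h4 : qHat q (x + y) = omega q x y * (qHat q x * qHat q y) := by
    rw [qHat, qHat, qHat, omega, ← AddChar.map_add_eq_mul, ← AddChar.map_add_eq_mul,
      QuadraticMap.polar]
    congr 1
    ring
  rw [h4] at h3
  have h5 : D.b x y * D.b y x = omega q x y := by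
    apply mul_right_cancel (b := qHat q x * qHat q y)
    rw [← h3]
    ac_rfl
  rw [← h5]
  change D.b x y / D.b y x = _
  rw [div_eq_mul_inv, inv_eq_of_mul_eq_one_left h2]

theorem PsData.nondegenerate [Finite k] (hq : (QuadraticMap.polarBilin q).Nondegenerate)
    (D : PsData 2 (qHat q)) : D.bichar.toCocycle.Nondegenerate := by
  intro x h
  apply omega_nondegenerate hq
  intro y
  rw [← D.alt_eq, Cocycle.alt, h, div_self']

variable [Finite k] (hq : (QuadraticMap.polarBilin q).Nondegenerate)

/-- The crossed system of `APs_k(V) = V̂ #_θ Sp_k(V) ⊆ V̂ #_θ Sp(V, ω)`. -/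
def apsSystem (D : APsData (omega q)) : CrossedSystem (SpLin q) (AddChar V ℂˣ) :=
  (D.lifts.weilSystem (D.nondegenerate hq)).comap (spIncl q)

/-- The crossed system of `Ps_k(V, q) = V̂ #_θ O_k(V, q) ⊆ V̂ #_θ O(V, q̂)`. -/
def psSystem (D : PsData 2 (qHat q)) : CrossedSystem (OrthLin q) (AddChar V ℂˣ) :=
  (D.lifts.weilSystem (D.nondegenerate hq)).comap (orthIncl q)

/-- The crossed system of `V̂ #_θ Ω_k(V, q) ⊆ Ps_k(V, q)`. -/
def omegaSystem (D : PsData 2 (qHat q)) : CrossedSystem (OmegaLin q) (AddChar V ℂˣ) :=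
  (psSystem hq D).comap (OmegaLin q).subtype

end Extensions

end

end PseudoSymplectic

/-!
A splitting of one of the extensions makes the group act on `ℂ_α[V]` by monomial automorphisms
`u_x ↦ c_g(x) u_{gx}` lifting its action on `V`. Let `u` be singular, `w ⊥ u`, and let `g` be the
Siegel transformation `x ↦ x + B(u, x) w - B(w, x) u - q(w) B(u, x) u`, an involution. Applying
`g² = 1` to `u_v`, where `B(u, v) = 1` and `B(w, v) = 0`, gives
`c_g(y) = Alt(α)(gv, v) = (-1)^{Tr q(w)}` for `y = v + gv = w + q(w) u`. On the other hand `c_g` is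
multiplicative on the vectors fixed by `g`, and `c_g(s) = 1` for every singular fixed `s` for which
some Siegel transformation `h` commuting with `g` maps some fixed vector `x` to `x + s`: compare
`c_{gh}(x)` with `c_{hg}(x)`. In dimension at least `8` there is room to write `y` as a sum of three
such `s`, and to choose `w` with `Tr q(w) = 1`, a contradiction. A Siegel transformation is induced
by conjugation by the even unit `1 + wu` of the Clifford algebra, so it has Dickson invariant zero
and the argument applies to all three groups.

The cochains exist because `α` may be taken to be `(-1)^C` for a bilinear form `C` over `𝔽₂`; then
`η_g` has to trivialize `(-1)^{C^g - C}`. If `g` preserves `q̂` then `C^g - C` is alternating, hence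
the polar form of a quadratic form; if `g` only preserves `ω` it is symmetric, and subtracting
`l ⊗ l`, where `l` is its diagonal, makes it alternating.
-/

namespace PseudoSymplectic

open QuadraticMap

section Polar

variable {k V : Type*} [Field k] [AddCommGroup V] [Module k V] {q : QuadraticForm k V}

theorem polar_map (g : OrthLin q) (x y : V) : polar q (g.1 x) (g.1 y) = polar q x y := by
  simp only [polar, ← map_add, g.2 _]

theorem polar_self_eq_zero [CharP k 2] (x : V) : polar q x x = 0 := by
  rw [polar_self, two_smul, CharTwo.add_self_eq_zero]

variable (q) in
/-- The orthogonal complement of the vectors `e` and `f` with respect to the polar form of `q`. -/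
def pairCompl (e f : V) : Submodule k V :=
  ((polarBilin q e).prod (polarBilin q f)).ker

theorem mem_pairCompl {e f x : V} :
    x ∈ pairCompl q e f ↔ polar q e x = 0 ∧ polar q f x = 0 := by
  simp [pairCompl]

end Polar

section Siegel

open CliffordAlgebra

variable {k V : Type*} [Field k] [AddCommGroup V] [Module k V] {q : QuadraticForm k V}

variable (q) in
/-- The formula of the Siegel (or Eichler) transformation attached to a singular vector `u` and a
vector `w` orthogonal to `u`; the underlying linear map is defined for all `u` and `w`. -/
def siegelLin (u w : V) : V →ₗ[k] V :=
  LinearMap.id + (polarBilin q u).smulRight w - (polarBilin q w).smulRight u -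
    q w • (polarBilin q u).smulRight u

theorem siegelLin_apply (u w x : V) : siegelLin q u w x =
    x + polar q u x • w - polar q w x • u - (q w * polar q u x) • u := by
  simp [siegelLin, smul_smul]

theorem siegelLin_zero_right (u : V) : siegelLin q u 0 = LinearMap.id := by
  ext x
  simp [siegelLin_apply]

variable {u w w' : V}

theorem siegelLin_comp_siegelLin (hu : q u = 0) (huw : polar q u w = 0) (huw' : polar q u w' = 0) :
    siegelLin q u w ∘ₗ siegelLin q u w' = siegelLin q u (w + w') := by
  have huu : polar q u u = 0 := by rw [polar_self, hu, smul_zero]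
  ext x
  simp only [LinearMap.comp_apply, siegelLin_apply, QuadraticMap.map_add q, polar_add_left,
    polar_add_right, polar_sub_right, polar_smul_right, huu, huw, huw', polar_comm q w u,
    smul_eq_mul, mul_zero, add_zero, sub_zero]
  module

/-- The Siegel (or Eichler) transformation attached to a singular vector `u` and a vector `w`
orthogonal to `u`, as an isometry. -/
def siegel (hu : q u = 0) (huw : polar q u w = 0) : OrthLin q :=
  ⟨.ofLinearMap (siegelLin q u w) (siegelLin q u (-w))
    (by rw [siegelLin_comp_siegelLin hu huw (by rw [polar_neg_right, huw, neg_zero]),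
      add_neg_cancel, siegelLin_zero_right])
    (by rw [siegelLin_comp_siegelLin hu (by rw [polar_neg_right, huw, neg_zero]) huw,
      neg_add_cancel, siegelLin_zero_right]),
    fun x => by
      change q (siegelLin q u w x) = q x
      simp only [siegelLin_apply, sub_eq_add_neg, ← neg_smul, QuadraticMap.map_add q,
        QuadraticMap.map_smul, polar_add_left, polar_smul_left, polar_smul_right, polar_self,
        polar_comm q x, polar_comm q w u, hu, huw, smul_eq_mul]
      ring⟩

theorem siegel_apply (hu : q u = 0) (huw : polar q u w = 0) (x : V) : (siegel hu huw).1 x =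
    x + polar q u x • w - polar q w x • u - (q w * polar q u x) • u :=
  siegelLin_apply u w x

theorem siegel_apply_of_mem_pairCompl (hu : q u = 0) (huw : polar q u w = 0) {x : V}
    (hx : x ∈ pairCompl q u w) : (siegel hu huw).1 x = x := by
  rw [mem_pairCompl] at hx
  simp [siegel_apply, hx]

theorem commute_siegel (hu : q u = 0) (huw : polar q u w = 0) {g : OrthLin q}
    (hgu : g.1 u = u) (hgw : g.1 w = w) : Commute g (siegel hu huw) := by
  ext x
  have hgux := polar_map g u x
  have hgwx := polar_map g w x
  rw [hgu] at hgux
  rw [hgw] at hgwx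
  simp [siegel_apply, hgu, hgw, hgux, hgwx]

theorem siegel_mul_self [CharP k 2] (hu : q u = 0) (huw : polar q u w = 0) :
    siegel hu huw * siegel hu huw = 1 := by
  apply Subtype.ext
  apply LinearEquiv.toLinearMap_injective
  change siegelLin q u w ∘ₗ siegelLin q u w = LinearMap.id
  rw [siegelLin_comp_siegelLin hu huw huw, ← two_smul k, CharTwo.two_eq_zero, zero_smul,
    siegelLin_zero_right]

theorem add_siegel_apply [CharP k 2] (hu : q u = 0) (huw : polar q u w = 0) {v : V}
    (huv : polar q u v = 1) (hwv : polar q w v = 0) :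
    v + (siegel hu huw).1 v = w + q w • u := by
  rw [siegel_apply, huv, hwv]
  linear_combination (norm := module) CharTwo.two_eq_zero (R := k) • (v - q w • u)

theorem mem_omegaLin_of_conj {g : OrthLin q} {e : CliffordAlgebra q} (he : e ∈ even q)
    (hunit : IsUnit e) (hconj : ∀ x, ι q (g.1 x) * e = e * ι q x) : g ∈ OmegaLin q := by
  change dickson g = 0
  rw [dickson_eq_zero_iff]
  intro z _ hcentral
  have hconj_all (y : CliffordAlgebra q) : cliffordMap g y * e = e * y := by
    induction y using CliffordAlgebra.induction with
    | algebraMap r => rw [AlgHom.commutes, Algebra.commutes]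
    | ι x =>
      rw [cliffordMap, CliffordAlgebra.map_apply_ι]
      exact hconj x
    | mul a b ha hb => rw [map_mul, mul_assoc, hb, ← mul_assoc, ha, mul_assoc]
    | add a b ha hb => rw [map_add, add_mul, ha, hb, mul_add]
  apply hunit.mul_right_cancel
  rw [hconj_all, hcentral e he]

theorem ι_mul_ι_mul_ι_eq_zero (hu : q u = 0) (huw : polar q u w = 0) :
    ι q u * (ι q w * ι q u) = 0 := by
  have hanti : ι q u * ι q w = -(ι q w * ι q u) := by
    rw [eq_neg_iff_add_eq_zero, ι_mul_ι_add_swap, huw, map_zero]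
  rw [← mul_assoc, hanti, neg_mul, mul_assoc, ι_sq_scalar, hu, map_zero, mul_zero, neg_zero]

theorem isUnit_one_add_ι_mul_ι (hu : q u = 0) (huw : polar q u w = 0) :
    IsUnit (1 + ι q w * ι q u) :=
  IsNilpotent.isUnit_one_add
    ⟨2, by rw [_root_.sq, mul_assoc, ι_mul_ι_mul_ι_eq_zero hu huw, mul_zero]⟩

theorem ι_siegel_mul (hu : q u = 0) (huw : polar q u w = 0) (x : V) :
    ι q ((siegel hu huw).1 x) * (1 + ι q w * ι q u) = (1 + ι q w * ι q u) * ι q x := by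
  have hww : ι q w * (ι q w * ι q u) = q w • ι q u := by
    rw [← mul_assoc, ι_sq_scalar, Algebra.smul_def]
  have hswap (y : V) : ι q y * ι q x = polar q y x • 1 - ι q x * ι q y := by
    rw [eq_sub_iff_add_eq, ι_mul_ι_add_swap, Algebra.algebraMap_eq_smul_one]
  have hwux : ι q w * ι q u * ι q x =
      polar q u x • ι q w - polar q w x • ι q u + ι q x * (ι q w * ι q u) := by
    rw [mul_assoc, hswap, mul_sub, mul_smul_one, ← mul_assoc, hswap, sub_mul, smul_one_mul,
      mul_assoc, sub_sub_eq_add_sub, sub_add_eq_add_sub]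
  simp only [siegel_apply, map_sub, map_add, map_smul, sub_mul, add_mul, mul_add, mul_one, one_mul,
    smul_mul_assoc, ι_mul_ι_mul_ι_eq_zero hu huw, hww, hwux]
  module

theorem siegel_mem_omegaLin (hu : q u = 0) (huw : polar q u w = 0) :
    siegel hu huw ∈ OmegaLin q :=
  mem_omegaLin_of_conj (add_mem (one_mem _) (ι_mul_ι_mem_evenOdd_zero q w u))
    (isUnit_one_add_ι_mul_ι hu huw) (ι_siegel_mul hu huw)

end Siegel

section Hyperbolic

open Module

variable {k V : Type*} [Field k] [AddCommGroup V] [Module k V] {q : QuadraticForm k V}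

theorem finrank_le_finrank_ker_add_finrank {M : Type*} [AddCommGroup M] [Module k M]
    [FiniteDimensional k V] [FiniteDimensional k M] (φ : V →ₗ[k] M) :
    finrank k V ≤ finrank k φ.ker + finrank k M := by
  rw [← φ.finrank_range_add_finrank_ker, add_comm]
  exact Nat.add_le_add_left (Submodule.finrank_le _) _

/-- As every element of `k` is a square, a vector orthogonal to an anisotropic `x` becomes singular
after adding a multiple of `x`. -/
theorem exists_ne_zero_map_eq_zero_of_three_le_finrank [CharP k 2] [PerfectRing k 2]
    (hdim : 3 ≤ finrank k V) : ∃ e ≠ 0, q e = 0 := by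
  have : FiniteDimensional k V := finite_of_finrank_pos (by omega)
  have : Nontrivial V := nontrivial_of_finrank_pos (R := k) (by omega)
  obtain ⟨x, hx⟩ := exists_ne (0 : V)
  by_cases hqx : q x = 0
  · exact ⟨x, hx, hqx⟩
  obtain ⟨y, hxy, hy⟩ : ∃ y ∈ (polarBilin q x).ker, y ∉ k ∙ x := by
    by_contra! hle
    have hker := finrank_le_finrank_ker_add_finrank (polarBilin q x)
    have hspan := Submodule.finrank_mono (show (polarBilin q x).ker ≤ k ∙ x from hle)
    rw [finrank_span_singleton hx] at hspan
    rw [finrank_self] at hker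
    omega
  obtain ⟨t, ht⟩ := surjective_frobenius k 2 (q y / q x)
  refine ⟨y + t • x, fun hyx => hy ?_, ?_⟩
  · rw [eq_neg_of_add_eq_zero_left hyx, ← neg_smul]
    exact Submodule.smul_mem _ _ (Submodule.mem_span_singleton_self x)
  · rw [frobenius_def, eq_div_iff hqx, _root_.sq] at ht
    have hyx : polar q y x = 0 := by rw [polar_comm]; exact hxy
    rw [QuadraticMap.map_add q, QuadraticMap.map_smul, polar_smul_right, hyx, smul_eq_mul, ht,
      smul_zero, add_zero, CharTwo.add_self_eq_zero]

theorem exists_polar_eq_one (hq : (polarBilin q).Nondegenerate) {e : V} (he : e ≠ 0) :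
    ∃ f, polar q e f = 1 := by
  obtain ⟨f, hf⟩ : ∃ f, polar q e f ≠ 0 := by
    by_contra! hperp
    exact he (hq.1 e hperp)
  exact ⟨(polar q e f)⁻¹ • f, by rw [polar_smul_right, smul_eq_mul, inv_mul_cancel₀ hf]⟩

theorem exists_map_eq_zero_polar_eq_one (hq : (polarBilin q).Nondegenerate) {e : V} (he : e ≠ 0)
    (hqe : q e = 0) : ∃ f, q f = 0 ∧ polar q e f = 1 := by
  obtain ⟨f, hef⟩ := exists_polar_eq_one hq he
  have hee : polar q e e = 0 := by rw [polar_self, hqe, smul_zero]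
  refine ⟨f + -q f • e, ?_, ?_⟩
  · rw [QuadraticMap.map_add q, QuadraticMap.map_smul, polar_smul_right, polar_comm, hef, hqe]
    simp
  · rw [polar_add_right, polar_smul_right, hef, hee, smul_zero, add_zero]

theorem finrank_le_finrank_pairCompl_add_two [FiniteDimensional k V] (e f : V) :
    finrank k V ≤ finrank k (pairCompl q e f) + 2 := by
  have hker := finrank_le_finrank_ker_add_finrank ((polarBilin q e).prod (polarBilin q f))
  rwa [finrank_prod, finrank_self] at hker

theorem nondegenerate_comp_subtype_pairCompl (hq : (polarBilin q).Nondegenerate) {e f : V}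
    (he : q e = 0) (hf : q f = 0) (hef : polar q e f = 1) :
    (polarBilin (q.comp (pairCompl q e f).subtype)).Nondegenerate := by
  have hrefl : (polarBilin (q.comp (pairCompl q e f).subtype)).IsRefl := fun x y hxy => by
    rw [← hxy]
    exact polar_comm _ y x
  rw [hrefl.nondegenerate_iff_separatingLeft]
  intro ⟨x, hx⟩ hperp
  obtain ⟨hex, hfx⟩ := mem_pairCompl.mp hx
  refine Subtype.ext (hq.1 x fun y => ?_)
  have hproj : y - polar q f y • e - polar q e y • f ∈ pairCompl q e f := by
    rw [mem_pairCompl]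
    simp [polar_sub_right, polar_smul_right, polar_self, he, hf, hef, polar_comm q f e]
  have hxproj : polar q x (y - polar q f y • e - polar q e y • f) = 0 := hperp ⟨_, hproj⟩
  simpa [polar_sub_right, polar_smul_right, polar_comm q x e, polar_comm q x f, hex, hfx]
    using hxproj

variable (q) in
/-- The vectors `e i, f i` form a symplectic basis, with respect to the polar form of `q`, of the
subspace which they span. -/
structure IsSymplecticFamily {ι : Type*} (e f : ι → V) : Prop where
  polar_left : ∀ i j, polar q (e i) (e j) = 0
  polar_right : ∀ i j, polar q (f i) (f j) = 0
  polar_left_right_self : ∀ i, polar q (e i) (f i) = 1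
  polar_left_right_of_ne : ∀ i j, i ≠ j → polar q (e i) (f j) = 0

namespace IsSymplecticFamily

theorem left_mem_pairCompl {ι : Type*} {e f : ι → V} (hef : IsSymplecticFamily q e f) {i j : ι}
    (hij : i ≠ j) : e j ∈ pairCompl q (e i) (f i) :=
  mem_pairCompl.mpr ⟨hef.polar_left i j, by
    rw [polar_comm, hef.polar_left_right_of_ne j i hij.symm]⟩

theorem right_mem_pairCompl {ι : Type*} {e f : ι → V} (hef : IsSymplecticFamily q e f) {i j : ι}
    (hij : i ≠ j) : f j ∈ pairCompl q (e i) (f i) :=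
  mem_pairCompl.mpr ⟨hef.polar_left_right_of_ne i j hij, hef.polar_right i j⟩

theorem cons {n : ℕ} {e₀ f₀ : V} {e f : Fin n → pairCompl q e₀ f₀}
    (hef : IsSymplecticFamily (q.comp (pairCompl q e₀ f₀).subtype) e f)
    (he₀ : q e₀ = 0) (hf₀ : q f₀ = 0) (hef₀ : polar q e₀ f₀ = 1) :
    IsSymplecticFamily q (Fin.cons e₀ fun i => (e i).1 : Fin (n + 1) → V)
      (Fin.cons f₀ fun i => (f i).1) where
  polar_left i j := by
    cases i using Fin.cases <;> cases j using Fin.cases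
    · simp [polar_self, he₀]
    · exact (mem_pairCompl.mp (e _).2).1
    · rw [polar_comm]
      exact (mem_pairCompl.mp (e _).2).1
    · exact hef.polar_left _ _
  polar_right i j := by
    cases i using Fin.cases <;> cases j using Fin.cases
    · simp [polar_self, hf₀]
    · exact (mem_pairCompl.mp (f _).2).2
    · rw [polar_comm]
      exact (mem_pairCompl.mp (f _).2).2
    · exact hef.polar_right _ _
  polar_left_right_self i := by
    cases i using Fin.cases
    · exact hef₀
    · exact hef.polar_left_right_self _
  polar_left_right_of_ne i j hij := by
    cases i using Fin.cases <;> cases j using Fin.cases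
    · exact absurd rfl hij
    · exact (mem_pairCompl.mp (f _).2).1
    · rw [polar_comm]
      exact (mem_pairCompl.mp (e _).2).2
    · exact hef.polar_left_right_of_ne _ _ fun h => hij (congrArg Fin.succ h)

end IsSymplecticFamily

theorem exists_isSymplecticFamily [CharP k 2] [PerfectRing k 2] {m : ℕ}
    (hq : (polarBilin q).Nondegenerate) (hdim : 2 * m + 1 ≤ finrank k V) :
    ∃ e f : Fin (m + 1) → V, IsSymplecticFamily q e f ∧
      ∀ i : Fin m, q (e i.castSucc) = 0 ∧ q (f i.castSucc) = 0 := by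
  have : FiniteDimensional k V := finite_of_finrank_pos (by omega)
  induction m generalizing V with
  | zero =>
    have : Nontrivial V := nontrivial_of_finrank_pos (R := k) (by omega)
    obtain ⟨e, he⟩ := exists_ne (0 : V)
    obtain ⟨f, hef⟩ := exists_polar_eq_one hq he
    have hfam : IsSymplecticFamily q (fun _ : Fin 1 => e) fun _ => f :=
      ⟨fun _ _ => polar_self_eq_zero e, fun _ _ => polar_self_eq_zero f, fun _ => hef,
        fun i j hij => absurd (Subsingleton.elim i j) hij⟩
    exact ⟨_, _, hfam, fun i => i.elim0⟩
  | succ m ih =>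
    obtain ⟨e₀, he₀, hqe₀⟩ := exists_ne_zero_map_eq_zero_of_three_le_finrank (q := q) (by omega)
    obtain ⟨f₀, hqf₀, hef₀⟩ := exists_map_eq_zero_polar_eq_one hq he₀ hqe₀
    have hcodim := finrank_le_finrank_pairCompl_add_two (q := q) e₀ f₀
    obtain ⟨e, f, hef, hsing⟩ := ih (nondegenerate_comp_subtype_pairCompl hq hqe₀ hqf₀ hef₀)
      (by omega) inferInstance
    exact ⟨_, _, hef.cons hqe₀ hqf₀ hef₀, Fin.cases ⟨hqe₀, hqf₀⟩ hsing⟩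

end Hyperbolic

section Monomial

variable {V Y : Type*} [AddCommGroup V] [Group Y]

/-- An action of `Y` on `ℂ_α[V]` by algebra automorphisms `u_x ↦ coeff g x • u_{ρ g x}`, that is, a
lift of `ρ : Y → Aut V` to the monomial automorphisms of the twisted group algebra. -/
structure MonomialAction (α : Cocycle V) (ρ : Y →* AutGrp V) where
  toHom : Y →* (α.Alg ≃ₐ[ℂ] α.Alg)
  coeff : Y → V → ℂˣ
  toHom_u : ∀ g x, toHom g (α.u x) = (coeff g x : ℂ) • α.u (ρ g x)

namespace MonomialAction

variable {α : Cocycle V} {ρ : Y →* AutGrp V} (M : MonomialAction α ρ) {g h : Y} {x y : V}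

theorem coeff_mul (g h : Y) (x : V) : M.coeff (g * h) x = M.coeff g (ρ h x) * M.coeff h x := by
  have happly := M.toHom_u (g * h) x
  rw [map_mul, AlgEquiv.mul_apply, M.toHom_u, map_smul, M.toHom_u, smul_smul, map_mul,
    LinearEquiv.mul_apply] at happly
  apply Units.ext
  rw [← α.smul_u_injective _ happly, Units.val_mul, mul_comm]

theorem coeff_one (x : V) : M.coeff 1 x = 1 := by
  simpa using M.coeff_mul 1 1 x

theorem coeff_add (g : Y) (x y : V) :
    α (ρ g x) (ρ g y) * (M.coeff g x * M.coeff g y) = α x y * M.coeff g (x + y) := by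
  have happly := map_mul (M.toHom g) (α.u x) (α.u y)
  simp only [α.u_mul_u, map_smul, M.toHom_u, smul_mul_smul_comm, smul_smul, map_add] at happly
  apply Units.ext
  push_cast
  rw [α.smul_u_injective _ happly, mul_comm]

theorem coeff_add_of_fixed (hx : ρ g x = x) (hy : ρ g y = y) :
    M.coeff g (x + y) = M.coeff g x * M.coeff g y := by
  have hadd := M.coeff_add g x y
  rw [hx, hy] at hadd
  exact (mul_left_cancel hadd).symm

/-- Both orders of `g` and `h` applied to `u x` give `coeff g x = coeff g (x + y)`. -/
theorem coeff_eq_one_of_commute (hgh : Commute g h) (hx : ρ g x = x) (hy : ρ g y = y)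
    (hhx : ρ h x = x + y) : M.coeff g y = 1 := by
  have hcomm : M.coeff (g * h) x = M.coeff (h * g) x := by rw [hgh.eq]
  rw [M.coeff_mul, M.coeff_mul, hhx, hx, mul_comm, M.coeff_add_of_fixed hx hy] at hcomm
  exact mul_eq_left.mp (mul_left_cancel hcomm)

theorem coeff_add_apply_of_mul_self_eq_one (hg : g * g = 1) (x : V) :
    M.coeff g (x + ρ g x) = α.alt (ρ g x) x := by
  have hgx : ρ g (ρ g x) = x := by rw [← LinearEquiv.mul_apply, ← map_mul, hg, map_one]; rfl
  have hadd := M.coeff_add g x (ρ g x)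
  rw [mul_comm (M.coeff g x), ← M.coeff_mul, hg, M.coeff_one, hgx, mul_one] at hadd
  rw [Cocycle.alt, hadd, mul_div_cancel_left]

end MonomialAction

namespace LiftFamily

variable {α : Cocycle V} {H : Subgroup (AutGrp V)} (L : LiftFamily α H) (hα : α.Nondegenerate)
  (f : Y →* H)

/-- The action `(χ, g) ↦ χ α_{f g}` of the crossed product on the twisted group algebra. -/
noncomputable def actionHom : ((L.weilSystem hα).comap f).Product →* (α.Alg ≃ₐ[ℂ] α.Alg) :=
  MonoidHom.mk' (fun p => α.diag p.fst * L.lift (f p.snd)) fun p r => by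
    have hdiag (ψ : AddChar V ℂˣ) : α.diag ψ = (α.dualEquiv hα ψ).1 := rfl
    rw [CrossedSystem.mul_def]
    simp only [CrossedSystem.comap, weilSystem, CrossedSystem.congr, autSystem, hdiag, map_mul,
      MulEquiv.apply_symm_apply, Subgroup.coe_mul]
    group

theorem actionHom_u (p : ((L.weilSystem hα).comap f).Product) (x : V) :
    L.actionHom hα f p (α.u x) =
      ((p.fst ((f p.snd).1 x) * L.η (f p.snd) x : ℂˣ) : ℂ) • α.u ((f p.snd).1 x) := by
  change α.diag p.fst (L.lift (f p.snd) (α.u x)) = _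
  rw [L.lift_u, map_smul, α.diag_u, smul_smul, Units.val_mul, mul_comm]

/-- A splitting makes `Y` act on the twisted group algebra through the crossed product. -/
noncomputable def monomialAction (s : ((L.weilSystem hα).comap f).extension.Splitting) :
    MonomialAction α (H.subtype.comp f) where
  toHom := (L.actionHom hα f).comp s.toMonoidHom
  coeff g x := (s g).fst ((f g).1 x) * L.η (f g) x
  toHom_u g x := by
    have hsnd : (s g).snd = g := s.rightInverse_rightHom g
    have happly := L.actionHom_u hα f (s g) x
    rwa [hsnd] at happly

end LiftFamily

end Monomial

section Obstruction

variable {k V Y : Type*} [Field k] [CharP k 2] [AddCommGroup V] [Module k V] [Group Y]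

/-- The image of `ρ` contains all Siegel transformations of `(V, q)`. -/
def ContainsSiegel (q : QuadraticForm k V) (ρ : Y →* AutGrp V) : Prop :=
  ∀ (u w : V) (hu : q u = 0) (huw : polar q u w = 0), ∃ g, ρ g = (orthIncl q (siegel hu huw)).1

variable {q : QuadraticForm k V} {α : Cocycle V} {ρ : Y →* AutGrp V} (M : MonomialAction α ρ)
  {u w : V} {hu : q u = 0} {huw : polar q u w = 0} {g : Y}

theorem apply_of_mem_pairCompl (hg : ρ g = (orthIncl q (siegel hu huw)).1) {x : V}
    (hx : x ∈ pairCompl q u w) : ρ g x = x := by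
  rw [hg]
  exact siegel_apply_of_mem_pairCompl hu huw hx

namespace MonomialAction

/-- The Siegel transformation of `(y, z)` commutes with `g` and maps `x` to `x + y`. -/
theorem coeff_eq_one_of_singular (hρ : Function.Injective ρ) (hS : ContainsSiegel q ρ)
    (hg : ρ g = (orthIncl q (siegel hu huw)).1) {x y z : V} (hzx : polar q z x = 1)
    (hz : z ∈ pairCompl q u w) (hx : x ∈ pairCompl q u w) (hy : y ∈ pairCompl q u w)
    (hyzx : y ∈ pairCompl q z x) (hqy : q y = 0) : M.coeff g y = 1 := by
  obtain ⟨hzy, hxy⟩ := mem_pairCompl.mp hyzx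
  rw [polar_comm] at hzy hxy
  obtain ⟨h, hh⟩ := hS y z hqy hzy
  have hhx : ρ h x = x + y := by
    rw [hh]
    change (siegel hqy hzy).1 x = x + y
    rw [siegel_apply, hxy, hzx, zero_smul, add_zero, mul_zero, zero_smul, sub_zero, one_smul,
      sub_eq_add_neg, ← neg_one_smul k, CharTwo.neg_eq, one_smul]
  have hcomm : Commute (ρ g) (ρ h) := by
    rw [hg, hh]
    exact (commute_siegel hqy hzy (siegel_apply_of_mem_pairCompl hu huw hy)
      (siegel_apply_of_mem_pairCompl hu huw hz)).map ((Orth (qHat q)).subtype.comp (orthIncl q))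
  exact M.coeff_eq_one_of_commute (hcomm.of_map hρ) (apply_of_mem_pairCompl hg hx)
    (apply_of_mem_pairCompl hg hy) hhx

/-- `y` is the sum of the singular vectors `e`, `q y • f` and `y + e + q y • f`. -/
theorem coeff_eq_one_of_mem_pairCompl (hρ : Function.Injective ρ) (hS : ContainsSiegel q ρ)
    (hg : ρ g = (orthIncl q (siegel hu huw)).1) {e f x y z : V} (hzx : polar q z x = 1)
    (hz : z ∈ pairCompl q u w) (hx : x ∈ pairCompl q u w) (hqe : q e = 0) (hqf : q f = 0)
    (hef : polar q e f = 1) (he : e ∈ pairCompl q u w ⊓ pairCompl q z x)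
    (hf : f ∈ pairCompl q u w ⊓ pairCompl q z x) (hy : y ∈ pairCompl q u w ⊓ pairCompl q z x)
    (hyef : y ∈ pairCompl q e f) : M.coeff g y = 1 := by
  have hsingular (t : V) (ht : t ∈ pairCompl q u w ⊓ pairCompl q z x) (hqt : q t = 0) :
      M.coeff g t = 1 :=
    M.coeff_eq_one_of_singular hρ hS hg hzx hz hx ht.1 ht.2 hqt
  have hadd {s t : V} (hs : s ∈ pairCompl q u w ⊓ pairCompl q z x)
      (ht : t ∈ pairCompl q u w ⊓ pairCompl q z x) :
      M.coeff g (s + t) = M.coeff g s * M.coeff g t :=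
    M.coeff_add_of_fixed (apply_of_mem_pairCompl hg hs.1) (apply_of_mem_pairCompl hg ht.1)
  have hcf := Submodule.smul_mem _ (q y) hf
  have hyef' := add_mem (add_mem hy he) hcf
  have hqyef : q (y + e + q y • f) = 0 := by
    obtain ⟨hey, hfy⟩ := mem_pairCompl.mp hyef
    rw [polar_comm] at hey hfy
    simp only [QuadraticMap.map_add q, QuadraticMap.map_smul, polar_add_left, polar_smul_right,
      hey, hfy, hqe, hqf, hef, smul_eq_mul, mul_zero, mul_one, add_zero, zero_add,
      CharTwo.add_self_eq_zero]
  have hsum : y = e + q y • f + (y + e + q y • f) := by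
    linear_combination (norm := module) -CharTwo.two_eq_zero (R := k) • (e + q y • f)
  rw [hsum, hadd (add_mem he hcf) hyef', hadd he hcf, hsingular e he hqe,
    hsingular _ hcf (by rw [QuadraticMap.map_smul, hqf, smul_zero]), hsingular _ hyef' hqyef,
    one_mul, one_mul]

theorem coeff_add_apply_siegel (hρ : Function.Injective ρ)
    (hα : ∀ x y, α.alt x y = omega q x y) (hg : ρ g = (orthIncl q (siegel hu huw)).1) {v : V}
    (huv : polar q u v = 1) (hwv : polar q w v = 0) :
    M.coeff g (w + q w • u) = traceChar k (q w) := by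
  have hgg : g * g = 1 := hρ (by
    rw [map_mul, hg, ← Subgroup.coe_mul, ← map_mul, siegel_mul_self]
    simp)
  have hgv : v + ρ g v = w + q w • u := by
    rw [hg]
    exact add_siegel_apply hu huw huv hwv
  rw [← hgv, M.coeff_add_apply_of_mul_self_eq_one hgg, hα, omega, eq_sub_of_add_eq' hgv,
    polar_sub_left, polar_add_left, polar_smul_left, huv, hwv, polar_self_eq_zero, zero_add,
    sub_zero, smul_eq_mul, mul_one]

theorem traceChar_eq_one (M : MonomialAction α ρ) (hρ : Function.Injective ρ)
    (hS : ContainsSiegel q ρ) (hα : ∀ x y, α.alt x y = omega q x y) {e f : Fin 4 → V}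
    (hef : IsSymplecticFamily q e f)
    (hsing : ∀ i : Fin 3, q (e i.castSucc) = 0 ∧ q (f i.castSucc) = 0) (c : k) :
    traceChar k c = 1 := by
  have hqe₀ : q (e 0) = 0 := (hsing 0).1
  obtain ⟨hqe₁, hqf₁⟩ : q (e 1) = 0 ∧ q (f 1) = 0 := hsing 1
  obtain ⟨hqe₂, hqf₂⟩ : q (e 2) = 0 ∧ q (f 2) = 0 := hsing 2
  obtain ⟨w, hw⟩ : ∃ w, w = e 1 + c • f 1 := ⟨_, rfl⟩
  have hqw : q w = c := by
    rw [hw, QuadraticMap.map_add q, QuadraticMap.map_smul, polar_smul_right, hqe₁, hqf₁,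
      hef.polar_left_right_self]
    simp
  have hw_mem {i : Fin 4} (hi : i ≠ 1) : w ∈ pairCompl q (e i) (f i) :=
    hw ▸ add_mem (hef.left_mem_pairCompl hi) (Submodule.smul_mem _ _ (hef.right_mem_pairCompl hi))
  obtain ⟨huw, hvw⟩ := mem_pairCompl.mp (hw_mem zero_ne_one)
  have hy_mem {i : Fin 4} (hi₀ : i ≠ 0) (hi₁ : i ≠ 1) :
      w + q w • e 0 ∈ pairCompl q (e i) (f i) :=
    add_mem (hw_mem hi₁) (Submodule.smul_mem _ _ (hef.left_mem_pairCompl hi₀))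
  have hy_mem_uw : w + q w • e 0 ∈ pairCompl q (e 0) w := by
    simp only [mem_pairCompl, polar_add_right, polar_smul_right, polar_self_eq_zero, huw,
      polar_comm q w (e 0), smul_zero, add_zero, and_self]
  have he_mem {i : Fin 4} (hi : i ≠ 1) : e i ∈ pairCompl q (e 0) w :=
    mem_pairCompl.mpr ⟨hef.polar_left 0 i, by
      rw [polar_comm, (mem_pairCompl.mp (hw_mem hi)).1]⟩
  have hf_mem {i : Fin 4} (hi₀ : i ≠ 0) (hi₁ : i ≠ 1) : f i ∈ pairCompl q (e 0) w :=
    mem_pairCompl.mpr ⟨hef.polar_left_right_of_ne 0 i hi₀.symm, by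
      rw [polar_comm, (mem_pairCompl.mp (hw_mem hi₁)).2]⟩
  obtain ⟨g, hg⟩ := hS (e 0) w hqe₀ huw
  rw [← hqw, ← M.coeff_add_apply_siegel hρ hα hg (hef.polar_left_right_self 0)
    (by rw [polar_comm, hvw])]
  exact M.coeff_eq_one_of_mem_pairCompl hρ hS hg (hef.polar_left_right_self 3)
    (he_mem (by decide)) (hf_mem (by decide) (by decide)) hqe₂ hqf₂
    (hef.polar_left_right_self 2)
    ⟨he_mem (by decide), hef.left_mem_pairCompl (by decide)⟩
    ⟨hf_mem (by decide) (by decide), hef.right_mem_pairCompl (by decide)⟩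
    ⟨hy_mem_uw, hy_mem (by decide) (by decide)⟩ (hy_mem (by decide) (by decide))

end MonomialAction

end Obstruction

section BilinearForms

variable {R V : Type*} [CommRing R] [AddCommGroup V] [Module R V] [Module.Free R V]
  {B : LinearMap.BilinForm R V}

/-- `D` is the strictly upper triangular part of the Gram matrix of `B` in a well-ordered basis. -/
theorem exists_sub_flip_eq_of_isAlt (hB : B.IsAlt) :
    ∃ D : LinearMap.BilinForm R V, D - D.flip = B := by
  classical
  let v := Module.Free.chooseBasis R V
  let _ : LinearOrder (Module.Free.ChooseBasisIndex R V) := IsWellOrder.linearOrder WellOrderingRel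
  refine ⟨v.constr R fun i => v.constr R fun j => if i < j then B (v i) (v j) else 0,
    v.ext fun i => v.ext fun j => ?_⟩
  simp only [LinearMap.sub_apply, LinearMap.BilinForm.flip_apply, Module.Basis.constr_basis]
  rcases lt_trichotomy i j with hij | rfl | hij
  · simp [hij, hij.not_gt]
  · simp [hB.self_eq_zero]
  · simp [hij, hij.not_gt, hB.neg_eq]

theorem exists_polarBilin_eq_of_isAlt [CharP R 2] (hB : B.IsAlt) :
    ∃ Q : QuadraticForm R V, Q.polarBilin = B := by
  obtain ⟨D, rfl⟩ := exists_sub_flip_eq_of_isAlt hB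
  refine ⟨D.toQuadraticMap, LinearMap.ext₂ fun x y => ?_⟩
  simp only [polarBilin_apply_apply, LinearMap.BilinMap.polar_toQuadraticMap,
    LinearMap.sub_apply, LinearMap.BilinForm.flip_apply, CharTwo.sub_eq_add]

end BilinearForms

section SignCharacter

/-- The nontrivial character `t ↦ (-1)^t` of `𝔽₂`. -/
noncomputable def signChar : AddChar (ZMod 2) ℂˣ := Circle.toUnits.compAddChar ZMod.toCircle

theorem signChar_injective : Function.Injective signChar := fun _ _ h =>
  ZMod.injective_toCircle (Circle.ext (congrArg Units.val h))

theorem signChar_mul_self (t : ZMod 2) : signChar t * signChar t = 1 := by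
  rw [← AddChar.map_add_eq_mul, CharTwo.add_self_eq_zero, AddChar.map_zero_eq_one]

theorem signChar_one : signChar 1 = -1 := by
  have hne : ((signChar 1 : ℂˣ) : ℂ) ≠ 1 := fun h =>
    one_ne_zero (signChar_injective ((Units.ext h).trans signChar.map_zero_eq_one.symm))
  have hsq : ((signChar 1 : ℂˣ) : ℂ) * signChar 1 = 1 := congrArg Units.val (signChar_mul_self 1)
  exact Units.ext ((mul_self_eq_one_iff.mp hsq).resolve_left hne)

/-- A square root of `-1` trivializes the class of `(s, t) ↦ (-1)^{st}` in `H²(𝔽₂, ℂˣ)`. -/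
theorem exists_map_add_eq_signChar_mul : ∃ σ : ZMod 2 → ℂˣ,
    ∀ s t, σ (s + t) = signChar (s * t) * (σ s * σ t) := by
  refine ⟨fun t => if t = 0 then 1 else Units.mk0 Complex.I Complex.I_ne_zero, fun s t => ?_⟩
  have hzero_or_one : ∀ t : ZMod 2, t = 0 ∨ t = 1 := by decide
  rcases hzero_or_one s with rfl | rfl <;> rcases hzero_or_one t with rfl | rfl
  · simp
  · simp
  · simp
  · rw [mul_one, signChar_one, CharTwo.add_self_eq_zero]
    apply Units.ext
    simp

end SignCharacter

section Cochains

variable {V : Type*} [AddCommGroup V]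

theorem isC01_one (n : ℕ) : IsC01 n (1 : V → ℂˣ) :=
  ⟨rfl, fun _ => one_pow n, ⟨fun _ _ _ => by simp, fun _ _ _ => by simp⟩, fun _ => by simp⟩

theorem exists_liftFamily {α : Cocycle V} {H : Subgroup (AutGrp V)} {p : (V → ℂˣ) → Prop}
    (hp : p 1) (hη : ∀ g : H, ∃ η, p η ∧
      ∀ x y, α (g.1 x) (g.1 y) * (η x * η y) = α x y * η (x + y)) :
    ∃ L : LiftFamily α H, ∀ g, p (L.η g) := by
  classical
  choose η hpη hη using hη
  refine ⟨⟨Function.update η 1 1, fun g x y => ?_, fun x => by simp⟩, fun g => ?_⟩ <;>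
    rcases eq_or_ne g 1 with rfl | hg
  · simp
  · simpa [hg] using hη g x y
  · simpa using hp
  · simpa [hg] using hpη g

variable [Module (ZMod 2) V]

theorem isBicharacter_signChar (C : LinearMap.BilinForm (ZMod 2) V) :
    IsBicharacter fun x y => signChar (C x y) :=
  ⟨fun x y z => by simp [AddChar.map_add_eq_mul], fun x y z => by simp [AddChar.map_add_eq_mul]⟩

theorem isC01_signChar (Q : QuadraticForm (ZMod 2) V) : IsC01 2 fun x => signChar (Q x) where
  zero := by simp
  pow x := by rw [pow_two, signChar_mul_self]
  bichar := by
    convert isBicharacter_signChar Q.polarBilin using 3 with x y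
    rw [← AddChar.map_add_eq_mul, ← AddChar.map_sub_eq_div, polarBilin_apply_apply, polar,
      CharTwo.sub_eq_add, CharTwo.sub_eq_add, CharTwo.sub_eq_add]
    ring_nf
  double x := by
    rw [pow_two, signChar_mul_self, ZModModule.add_self]
    simp

/-- The diagonal of `E` is additive, say `E x x = l x`, and `E - l ⊗ l` is alternating. -/
theorem exists_map_add_eq_signChar_mul_of_isSymm {E : LinearMap.BilinForm (ZMod 2) V}
    (hE : E.IsSymm) : ∃ η : V → ℂˣ, ∀ x y, η (x + y) = signChar (E x y) * (η x * η y) := by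
  let l : V →ₗ[ZMod 2] ZMod 2 := AddMonoidHom.toZModLinearMap 2
    { toFun := fun x => E x x
      map_zero' := by simp
      map_add' := fun x y => by
        simp only [map_add, LinearMap.add_apply, hE.eq y x]
        linear_combination CharTwo.add_self_eq_zero (E x y) }
  have hl (x : V) : l x = E x x := rfl
  obtain ⟨Q, hQ⟩ := exists_polarBilin_eq_of_isAlt (B := E - l.smulRight l) fun x => by
    have hidem : ∀ t : ZMod 2, t - t * t = 0 := by decide
    simpa [hl] using hidem (E x x)
  have hpolar (x y : V) : Q (x + y) = E x y - l x * l y + Q x + Q y := by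
    have hxy := LinearMap.congr_fun₂ hQ x y
    simp only [polarBilin_apply_apply, polar, LinearMap.sub_apply, LinearMap.smulRight_apply,
      LinearMap.smul_apply, smul_eq_mul] at hxy
    linear_combination hxy
  obtain ⟨σ, hσ⟩ := exists_map_add_eq_signChar_mul
  refine ⟨fun x => signChar (Q x) * σ (l x), fun x y => ?_⟩
  beta_reduce
  have hE_split : signChar (E x y) = signChar (E x y - l x * l y) * signChar (l x * l y) := by
    rw [← AddChar.map_add_eq_mul, sub_add_cancel]
  rw [hpolar, AddChar.map_add_eq_mul, AddChar.map_add_eq_mul, map_add, hσ, hE_split]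
  ac_rfl

/-- The failure `C(gx, gy) - C(x, y)` of `g` to preserve a bilinear form `C` over `𝔽₂`. -/
def defect (C : LinearMap.BilinForm (ZMod 2) V) (g : AutGrp V) : LinearMap.BilinForm (ZMod 2) V :=
  let G : V →ₗ[ZMod 2] V := AddMonoidHom.toZModLinearMap 2 g.toLinearMap.toAddMonoidHom
  C.compl₁₂ G G - C

theorem defect_apply (C : LinearMap.BilinForm (ZMod 2) V) (g : AutGrp V) (x y : V) :
    defect C g x y = C (g x) (g y) - C x y :=
  rfl

theorem signChar_coboundary {C : LinearMap.BilinForm (ZMod 2) V} {g : AutGrp V} {η : V → ℂˣ}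
    (hη : ∀ x y, η (x + y) = signChar (defect C g x y) * (η x * η y)) (x y : V) :
    signChar (C (g x) (g y)) * (η x * η y) = signChar (C x y) * η (x + y) := by
  rw [hη, ← mul_assoc (signChar (C x y)), ← AddChar.map_add_eq_mul, defect_apply, add_sub_cancel]

theorem nonempty_psData_signChar (Q : QuadraticForm (ZMod 2) V) :
    Nonempty (PsData 2 fun x => signChar (Q x)) := by
  obtain ⟨C, rfl⟩ := LinearMap.BilinMap.toQuadraticMap_surjective Q
  have hbichar := isBicharacter_signChar C
  obtain ⟨L, hL⟩ := exists_liftFamily (α := hbichar.toCocycle)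
    (H := Orth fun x => signChar (C.toQuadraticMap x)) (isC01_one 2) fun g => by
    obtain ⟨P, hP⟩ := exists_polarBilin_eq_of_isAlt (B := defect C g.1) fun x =>
      sub_eq_zero.mpr (signChar_injective (g.2 x))
    refine ⟨_, isC01_signChar P, signChar_coboundary fun x y => ?_⟩
    rw [← hP, ← AddChar.map_add_eq_mul, ← AddChar.map_add_eq_mul, polarBilin_apply_apply, polar]
    congr 1
    ring
  exact ⟨⟨_, hbichar, fun _ => rfl, L, hL⟩⟩

theorem nonempty_apsData_signChar {B : LinearMap.BilinForm (ZMod 2) V} (hB : B.IsAlt) :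
    Nonempty (APsData fun x y => signChar (B x y)) := by
  obtain ⟨C, rfl⟩ := exists_sub_flip_eq_of_isAlt hB
  have hbichar := isBicharacter_signChar C
  obtain ⟨L, -⟩ := exists_liftFamily (α := hbichar.toCocycle)
    (H := Sp fun x y => signChar ((C - C.flip) x y)) (p := fun _ => True) trivial fun g => by
    have hsymm : (defect C g.1).IsSymm := ⟨fun x y => by
      have hg : C (g.1 x) (g.1 y) - C (g.1 y) (g.1 x) = C x y - C y x :=
        signChar_injective (g.2 x y)
      rw [defect_apply, defect_apply]
      linear_combination hg⟩
    obtain ⟨η, hη⟩ := exists_map_add_eq_signChar_mul_of_isSymm hsymm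
    exact ⟨η, trivial, signChar_coboundary hη⟩
  exact ⟨⟨hbichar.toCocycle, fun x y => (AddChar.map_sub_eq_div signChar (C x y) (C y x)).symm, L⟩⟩

end Cochains

section Existence

variable {k V : Type*} [Field k] [CharP k 2] [AddCommGroup V] [Module k V]

theorem exists_qHat_eq_signChar (q : QuadraticForm k V) :
    ∃ (_ : Module (ZMod 2) V) (Q : QuadraticForm (ZMod 2) V), ∀ x, qHat q x = signChar (Q x) :=
  let _ := ZMod.algebra k 2
  let _ : Module (ZMod 2) V := AddCommGroup.zmodModule fun x => by
    rw [← Nat.cast_smul_eq_nsmul k, Nat.cast_ofNat, CharTwo.two_eq_zero, zero_smul]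
  ⟨inferInstance, (Algebra.trace (ZMod 2) k).compQuadraticMap' q, fun _ => rfl⟩

theorem nonempty_psData (q : QuadraticForm k V) : Nonempty (PsData 2 (qHat q)) := by
  obtain ⟨_, Q, hQ⟩ := exists_qHat_eq_signChar q
  rw [funext hQ]
  exact nonempty_psData_signChar Q

theorem nonempty_apsData (q : QuadraticForm k V) : Nonempty (APsData (omega q)) := by
  obtain ⟨_, Q, hQ⟩ := exists_qHat_eq_signChar q
  have homega (x y : V) : omega q x y = signChar (Q.polarBilin x y) := by
    simp only [polarBilin_apply_apply, omega, polar, AddChar.map_sub_eq_div, ← hQ, qHat]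
  rw [funext₂ homega]
  refine nonempty_apsData_signChar fun x => ?_
  rw [polarBilin_apply_apply, polar_self, two_smul, CharTwo.add_self_eq_zero]

end Existence

section Nonsplitting

variable {k V : Type*} [Field k] [CharP k 2] [AddCommGroup V] [Module k V] {q : QuadraticForm k V}

theorem spIncl_injective : Function.Injective (spIncl q) := fun _ _ hgh =>
  Subtype.ext (LinearEquiv.restrictScalars_injective ℤ (congrArg Subtype.val hgh))

theorem orthIncl_injective : Function.Injective (orthIncl q) := fun _ _ hgh =>
  Subtype.ext (LinearEquiv.restrictScalars_injective ℤ (congrArg Subtype.val hgh))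

theorem containsSiegel_spIncl : ContainsSiegel q ((Sp (omega q)).subtype.comp (spIncl q)) :=
  fun _ _ hu huw => ⟨⟨(siegel hu huw).1, polar_map _⟩, rfl⟩

theorem containsSiegel_orthIncl : ContainsSiegel q ((Orth (qHat q)).subtype.comp (orthIncl q)) :=
  fun _ _ hu huw => ⟨siegel hu huw, rfl⟩

theorem containsSiegel_orthIncl_comp_subtype :
    ContainsSiegel q ((Orth (qHat q)).subtype.comp ((orthIncl q).comp (OmegaLin q).subtype)) :=
  fun _ _ hu huw => ⟨⟨siegel hu huw, siegel_mem_omegaLin hu huw⟩, rfl⟩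

theorem isEmpty_splitting [Finite k] {Y : Type*} [Group Y] {α : Cocycle V}
    {H : Subgroup (AutGrp V)} (hq : (polarBilin q).Nondegenerate)
    (hdim : 7 ≤ Module.finrank k V) (L : LiftFamily α H) (hα : α.Nondegenerate)
    (halt : ∀ x y, α.alt x y = omega q x y) {f : Y →* H} (hf : Function.Injective f)
    (hS : ContainsSiegel q (H.subtype.comp f)) :
    IsEmpty ((L.weilSystem hα).comap f).extension.Splitting := by
  refine ⟨fun s => ?_⟩
  let _ := ZMod.algebra k 2
  obtain ⟨c, hc⟩ := Algebra.trace_surjective (ZMod 2) k 1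
  obtain ⟨e, e', hfam, hsing⟩ := exists_isSymplecticFamily (m := 3) hq hdim
  have htrace : traceChar k c = 1 := (L.monomialAction hα f s).traceChar_eq_one
    (Subtype.val_injective.comp hf) hS halt hfam hsing c
  rw [traceChar_eq_one_iff, hc] at htrace
  exact one_ne_zero htrace

end Nonsplitting

end PseudoSymplectic

theorem mainTheorem8 {k V : Type*} [Field k] [Finite k] [CharP k 2] [AddCommGroup V] [Module k V]
    (q : QuadraticForm k V) (hq : (QuadraticMap.polarBilin q).Nondegenerate)
    (n : ℕ) (hn : 4 ≤ n) (hdim : Module.finrank k V = 2 * n) :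
    (Nonempty (PseudoSymplectic.APsData (PseudoSymplectic.omega q)) ∧
      Nonempty (PseudoSymplectic.PsData 2 (PseudoSymplectic.qHat q))) ∧
    (∀ D : PseudoSymplectic.APsData (PseudoSymplectic.omega q),
      IsEmpty (PseudoSymplectic.apsSystem hq D).extension.Splitting) ∧
    (∀ D : PseudoSymplectic.PsData 2 (PseudoSymplectic.qHat q),
      IsEmpty (PseudoSymplectic.psSystem hq D).extension.Splitting) ∧
    (∀ D : PseudoSymplectic.PsData 2 (PseudoSymplectic.qHat q),
      IsEmpty (PseudoSymplectic.omegaSystem hq D).extension.Splitting) := by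
  have hdim' : 7 ≤ Module.finrank k V := by omega
  refine ⟨⟨PseudoSymplectic.nonempty_apsData q, PseudoSymplectic.nonempty_psData q⟩,
    fun D => ?_, fun D => ?_, fun D => ?_⟩
  · exact PseudoSymplectic.isEmpty_splitting hq hdim' D.lifts (D.nondegenerate hq) D.alt_eq
      PseudoSymplectic.spIncl_injective PseudoSymplectic.containsSiegel_spIncl
  · exact PseudoSymplectic.isEmpty_splitting hq hdim' D.lifts (D.nondegenerate hq) D.alt_eq
      PseudoSymplectic.orthIncl_injective PseudoSymplectic.containsSiegel_orthIncl
  · exact PseudoSymplectic.isEmpty_splitting hq hdim' D.lifts (D.nondegenerate hq) D.alt_eq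
      (f := (PseudoSymplectic.orthIncl q).comp (PseudoSymplectic.OmegaLin q).subtype)
      (PseudoSymplectic.orthIncl_injective.comp (Subgroup.subtype_injective _))
      PseudoSymplectic.containsSiegel_orthIncl_comp_subtype
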